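/- Let $k$ be a field of characteristic $0$, and let $\Theta$ be the variety of all Jordan algebras over $k$, that is, of all (not necessarily unital, not necessarily associative) $k$-algebras satisfying the identities $xy=yx$ and $((xx)y)x=(xx)(yx)$. Fix a countably infinite set of symbols $X_0=\{x_1,x_2,\dots\}$ and let $\Theta^0$ be the category whose objects are the free Jordan algebras $F(X)$ over $k$ on the finite subsets $X\subset X_0$ (one object for each $X$, with $X=\varnothing$ allowed) and whose morphisms are all homomorphisms of $k$-algebras. Let $\mathfrak{A}$ be the group, under composition, of all automorphisms of the category $\Theta^0$ (functors $\Theta^0\to\Theta^0$ with a strict two-sided inverse), and let $\mathfrak{Y}$ be the normal subgroup of inner automorphisms, i.e. of those automorphisms that are isomorphic, as functors, to the identity functor of $\Theta^0$. Then there is an isomorphism of groups $$\mathfrak{A}/\mathfrak{Y}\;\cong\;\mathrm{Aut}\,k,$$ where $\mathrm{Aut}\,k$ is the group of all field automorphisms of $k$. -/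

import Mathlib

open CategoryTheory

universe u

noncomputable section

section FreeJordan

variable (k : Type u) [Field k] (X : Type)

/-- The relation on the absolutely free (non-unital, non-associative) `k`-algebra on `X`
that generates the congruence of all consequences of the laws `a b = b a` and
`((a a) b) a = (a a) (b a)`. -/
inductive FreeJordanRel :
    FreeNonUnitalNonAssocAlgebra k X → FreeNonUnitalNonAssocAlgebra k X → Prop
  | mul_comm (a b : FreeNonUnitalNonAssocAlgebra k X) : FreeJordanRel (a * b) (b * a)
  | jordan (a b : FreeNonUnitalNonAssocAlgebra k X) :
      FreeJordanRel (((a * a) * b) * a) ((a * a) * (b * a))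
  | smul (t : k) {a b : FreeNonUnitalNonAssocAlgebra k X} :
      FreeJordanRel a b → FreeJordanRel (t • a) (t • b)
  | add_right {a b : FreeNonUnitalNonAssocAlgebra k X} (c : FreeNonUnitalNonAssocAlgebra k X) :
      FreeJordanRel a b → FreeJordanRel (a + c) (b + c)
  | mul_left (a : FreeNonUnitalNonAssocAlgebra k X) {b c : FreeNonUnitalNonAssocAlgebra k X} :
      FreeJordanRel b c → FreeJordanRel (a * b) (a * c)
  | mul_right {a b : FreeNonUnitalNonAssocAlgebra k X} (c : FreeNonUnitalNonAssocAlgebra k X) :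
      FreeJordanRel a b → FreeJordanRel (a * c) (b * c)

/-- The free Jordan algebra over `k` (not assumed to have a unit) on the set `X`: the quotient
of the absolutely free algebra by the congruence generated by the Jordan algebra laws. -/
def FreeJordanAlgebra : Type u := Quot (FreeJordanRel k X)

end FreeJordan

namespace FreeJordanAlgebra

variable (k : Type u) [Field k] (X : Type)

theorem rel_add_left (a : FreeNonUnitalNonAssocAlgebra k X)
    {b c : FreeNonUnitalNonAssocAlgebra k X} (h : FreeJordanRel k X b c) :
    FreeJordanRel k X (a + b) (a + c) := by
  rw [add_comm a b, add_comm a c]; exact h.add_right a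

theorem rel_neg {a b : FreeNonUnitalNonAssocAlgebra k X} (h : FreeJordanRel k X a b) :
    FreeJordanRel k X (-a) (-b) := by
  simpa only [neg_one_smul] using h.smul (-1)

theorem rel_nsmul (n : ℕ) (a b : FreeNonUnitalNonAssocAlgebra k X) (h : FreeJordanRel k X a b) :
    FreeJordanRel k X (n • a) (n • b) := by
  simpa only [Nat.cast_smul_eq_nsmul] using h.smul (n : k)

theorem rel_zsmul (n : ℤ) (a b : FreeNonUnitalNonAssocAlgebra k X) (h : FreeJordanRel k X a b) :
    FreeJordanRel k X (n • a) (n • b) := by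
  simpa only [Int.cast_smul_eq_zsmul] using h.smul (n : k)

instance : Zero (FreeJordanAlgebra k X) where zero := Quot.mk _ 0

instance : Add (FreeJordanAlgebra k X) where
  add := Quot.map₂ (· + ·) (fun a _ _ h => rel_add_left k X a h) fun _ _ c h => h.add_right c

instance : Neg (FreeJordanAlgebra k X) where
  neg := Quot.map Neg.neg fun _ _ h => rel_neg k X h

instance : Sub (FreeJordanAlgebra k X) where
  sub := Quot.map₂ Sub.sub
    (fun a b c h => by
      change FreeJordanRel k X (a - b) (a - c)
      simpa only [sub_eq_add_neg] using rel_add_left k X a (rel_neg k X h))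
    fun a b c h => by
      change FreeJordanRel k X (a - c) (b - c)
      simpa only [sub_eq_add_neg] using h.add_right (-c)

instance : Mul (FreeJordanAlgebra k X) where
  mul := Quot.map₂ (· * ·) (fun a _ _ h => h.mul_left a) fun _ _ c h => h.mul_right c

instance : SMul k (FreeJordanAlgebra k X) where
  smul t := Quot.map (t • ·) fun _ _ h => h.smul t

instance : SMul ℕ (FreeJordanAlgebra k X) where
  smul n := Quot.map (n • ·) (rel_nsmul k X n)

instance : SMul ℤ (FreeJordanAlgebra k X) where
  smul n := Quot.map (n • ·) (rel_zsmul k X n)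

instance : NonUnitalNonAssocRing (FreeJordanAlgebra k X) :=
  Function.Surjective.nonUnitalNonAssocRing (Quot.mk _) Quot.mk_surjective rfl
    (fun _ _ => rfl) (fun _ _ => rfl) (fun _ => rfl) (fun _ _ => rfl)
    (fun _ _ => rfl) (fun _ _ => rfl)

instance : NonUnitalNonAssocCommRing (FreeJordanAlgebra k X) where
  mul_comm := by
    rintro ⟨a⟩ ⟨b⟩
    exact Quot.sound (FreeJordanRel.mul_comm a b)

instance : Module k (FreeJordanAlgebra k X) :=
  Function.Surjective.module k
    (⟨⟨Quot.mk (FreeJordanRel k X), rfl⟩, fun _ _ => rfl⟩ :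
      FreeNonUnitalNonAssocAlgebra k X →+ FreeJordanAlgebra k X)
    Quot.mk_surjective (fun _ _ => rfl)

instance : IsScalarTower k (FreeJordanAlgebra k X) (FreeJordanAlgebra k X) where
  smul_assoc := by
    rintro t ⟨a⟩ ⟨b⟩
    exact congrArg (Quot.mk (FreeJordanRel k X)) (smul_mul_assoc t a b)

instance : SMulCommClass k (FreeJordanAlgebra k X) (FreeJordanAlgebra k X) where
  smul_comm := by
    rintro t ⟨a⟩ ⟨b⟩
    exact congrArg (Quot.mk (FreeJordanRel k X)) (mul_smul_comm t a b).symm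

instance : IsCommJordan (FreeJordanAlgebra k X) where
  lmul_comm_rmul_rmul := by
    intro a b
    have h : ((a * a) * b) * a = (a * a) * (b * a) := by
      obtain ⟨a, rfl⟩ := Quot.mk_surjective a
      obtain ⟨b, rfl⟩ := Quot.mk_surjective b
      exact Quot.sound (FreeJordanRel.jordan a b)
    rw [mul_comm (a * b), mul_comm a b, ← h, mul_comm _ a, mul_comm (a * a) b]

/-- The canonical image of a free generator. -/
def of (x : X) : FreeJordanAlgebra k X :=
  Quot.mk _ (FreeNonUnitalNonAssocAlgebra.of k x)

end FreeJordanAlgebra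

/-- An object of the category of finitely generated free Jordan algebras over `k`: the free
algebra `F(X)` on a finite subset `X` of a fixed countable set of symbols, here indexed by `ℕ`
(the empty subset is allowed). Different subsets give different objects. -/
@[ext]
structure FreeJordanCat (k : Type u) [Field k] : Type where
  gens : Finset ℕ

namespace FreeJordanCat

variable (k : Type u) [Field k]

/-- The free Jordan algebra `F(X)` underlying an object. -/
abbrev algebra (A : FreeJordanCat k) : Type u := FreeJordanAlgebra k A.gens

/-- Morphisms are all homomorphisms of `k`-algebras. -/
instance : Category.{u} (FreeJordanCat k) where
  Hom A B := A.algebra k →ₙₐ[k] B.algebra k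
  id A := NonUnitalAlgHom.id k (A.algebra k)
  comp f g := NonUnitalAlgHom.comp g f

/-- The group of all automorphisms of the category, i.e. of all functors from the category to
itself that have a strict two-sided inverse; the product is the composition. -/
abbrev AutGroup : Type u := Aut (Cat.of (FreeJordanCat k))

/-- The normal subgroup of all inner automorphisms: those isomorphic, as functors, to the identity
functor. -/
def innerSubgroup : Subgroup (AutGroup k) where
  carrier := {Φ | Nonempty (𝟭 (FreeJordanCat k) ≅ Φ.hom.toFunctor)}
  one_mem' := ⟨Iso.refl _⟩
  mul_mem' := by
    rintro Φ Ψ ⟨e⟩ ⟨f⟩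
    exact ⟨f ≪≫ (Functor.rightUnitor _).symm ≪≫ Functor.isoWhiskerLeft Ψ.hom.toFunctor e⟩
  inv_mem' := by
    rintro Φ ⟨e⟩
    exact ⟨eqToIso (congrArg Cat.Hom.toFunctor Φ.hom_inv_id).symm ≪≫
      (Functor.isoWhiskerRight e Φ.inv.toFunctor).symm ≪≫ Functor.leftUnitor _⟩

instance : (innerSubgroup k).Normal where
  conj_mem := by
    rintro Φ ⟨e⟩ Ψ
    exact ⟨eqToIso (congrArg Cat.Hom.toFunctor Ψ.inv_hom_id).symm ≪≫
      Functor.isoWhiskerLeft Ψ.inv.toFunctor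
        ((Functor.leftUnitor _).symm ≪≫ Functor.isoWhiskerRight e Ψ.hom.toFunctor)⟩

end FreeJordanCat

end

/-!
Homomorphisms `F(x) → A` correspond to elements of `A`, and an autoequivalence `Φ` fixes `F(x)` up
to isomorphism because the rank of a free algebra is visible in the category. Hence `Φ` moves the
elements of each `A` bijectively and naturally to those of `Φ(A)`. Jordan algebras are power
associative, so `F(x)` embeds into the polynomials in one variable and its automorphisms are the
nonzero homotheties; thus `Φ` permutes the homotheties of every `A`, through a multiplicative
bijection `σ` of `k`.

The addition carried back from `Φ(A)` is given by an element of `F(x, y)` that is homogeneous of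
degree one for all substitutions `x ↦ t x, y ↦ t y`, so it is linear, and its values on the axes
show that it is `x + y`. Likewise the product is given by an element homogeneous of degree one in
each variable, which is a scalar multiple of `x y`. Hence `σ` is a field automorphism and, after
rescaling, `Φ` acts by conjugation with `σ`-semilinear ring isomorphisms, which makes it isomorphic
to the functor twisting scalars by `σ`. That functor is inner only for `σ = 1`, by naturality with
respect to the homotheties of `F(x)`.
-/

noncomputable section

section PowerAssociative

variable {A : Type*}

/-- The right-normed power `a * (a * (⋯ * a))` of exponent `n + 1`; the shift avoids the power of
exponent `0`, which has no meaning in an algebra without unit. -/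
def powSucc [Mul A] (a : A) : ℕ → A
  | 0 => a
  | n + 1 => a * powSucc a n

local notation "L" => AddMonoid.End.mulLeft

variable [NonUnitalNonAssocCommRing A] [IsCommJordan A]

attribute [local instance] LieRing.ofAssociativeRing

theorem lie_mulLeft_mul_add_lie_add_lie (h2 : IsSMulRegular A 2) (x y z : A) :
    ⁅L x, L (y * z)⁆ + ⁅L y, L (z * x)⁆ + ⁅L z, L (x * y)⁆ = 0 := by
  ext w
  have h := DFunLike.congr_fun (two_nsmul_lie_lmul_lmul_add_add_eq_zero x y z) w
  exact h2 (h.trans (smul_zero 2).symm)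

/-- The linearized Jordan identity at `(w, a ^ (n + 1), a)`, solved for `a ^ (n + 3) * w`. -/
theorem mulLeft_powSucc_add_two (h2 : IsSMulRegular A 2) (a : A) (n : ℕ) :
    L (powSucc a (n + 2)) = L (powSucc a (n + 1)) * L a + L (powSucc a (n + 1)) * L a +
      L (a * a) * L (powSucc a n) - L (powSucc a n) * (L a * L a) -
      L a * (L a * L (powSucc a n)) := by
  ext w
  set p := powSucc a n
  have linearized : w * ((p * a) * a) - (p * a) * (w * a) +
      (p * ((a * w) * a) - (a * w) * (p * a)) + (a * ((w * p) * a) - (w * p) * (a * a)) = 0 :=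
    DFunLike.congr_fun (lie_mulLeft_mul_add_lie_add_lie h2 w p a) a
  have sorted : a * (a * p) * w - (a * p) * (a * w) + (p * (a * (a * w)) - (a * p) * (a * w)) +
      (a * (a * (p * w)) - (a * a) * (p * w)) = 0 := by
    simpa only [mul_comm] using linearized
  change a * (a * p) * w = (a * p) * (a * w) + (a * p) * (a * w) + (a * a) * (p * w) -
    p * (a * (a * w)) - a * (a * (p * w))
  rw [← sub_eq_zero, ← sorted]
  abel

theorem commute_mulLeft_powSucc (h2 : IsSMulRegular A 2) (a : A) (n : ℕ) :
    Commute (L a) (L (powSucc a n)) := by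
  have commute_sq : Commute (L a) (L (a * a)) := commute_lmul_lmul_sq a
  induction n using Nat.twoStepInduction with
  | zero => exact .refl _
  | one => exact commute_sq
  | more n ih ih' =>
    have ha : Commute (L a) (L a) := .refl _
    rw [mulLeft_powSucc_add_two h2]
    exact ((((ih'.mul_right ha).add_right (ih'.mul_right ha)).add_right
      (commute_sq.mul_right ih)).sub_right (ih.mul_right (ha.mul_right ha))).sub_right
      (ha.mul_right (ha.mul_right ih))

theorem powSucc_mul_powSucc (h2 : IsSMulRegular A 2) (a : A) (m n : ℕ) :
    powSucc a m * powSucc a n = powSucc a (m + n + 1) := by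
  induction n with
  | zero => exact mul_comm _ _
  | succ n ih =>
    have h := DFunLike.congr_fun (commute_mulLeft_powSucc h2 a m) (powSucc a n)
    exact h.symm.trans (congrArg (a * ·) ih)

end PowerAssociative

section Weights

/-- The common eigenspace containing `w` is independent of the others, hence the eigenvectors `v i`
with `χ i ≠ χ₀` do not contribute to `w`. -/
theorem mem_span_of_forall_apply_eq_smul {k V ι T : Type*} [Field k] [AddCommGroup V] [Module k V]
    {f : T → Module.End k V} (comm : ∀ s t, Commute (f s) (f t)) {χ : ι → T → k} {v : ι → V}
    (hv : ∀ i t, f t (v i) = χ i t • v i) {χ₀ : T → k} {w : V} (hw : ∀ t, f t w = χ₀ t • w)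
    (mem_span : w ∈ Submodule.span k (Set.range v)) :
    w ∈ Submodule.span k (v '' {i | χ i = χ₀}) := by
  let W (ψ : T → k) : Submodule k V := ⨅ t, (f t).maxGenEigenspace (ψ t)
  have mem_W {ψ : T → k} {u : V} (hu : ∀ t, f t u = ψ t • u) : u ∈ W ψ :=
    (Submodule.mem_iInf _).2 fun t =>
      (Module.End.genEigenspace (f t) (ψ t)).mono le_top (Module.End.mem_eigenspace_iff.2 (hu t))
  have independent : iSupIndep W :=
    Module.End.independent_iInf_maxGenEigenspace_of_forall_mapsTo f fun s t φ =>
      Module.End.mapsTo_maxGenEigenspace_of_comm (comm t s) φ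
  rw [← Set.image_univ, ← Set.union_compl_self {i | χ i = χ₀}, Set.image_union,
    Submodule.span_union] at mem_span
  obtain ⟨w₁, hw₁, w₂, hw₂, rfl⟩ := Submodule.mem_sup.1 mem_span
  have w₁_mem : w₁ ∈ W χ₀ := Submodule.span_le.2 (by
    rintro _ ⟨i, rfl, rfl⟩
    exact mem_W (hv i)) hw₁
  have w₂_mem_iSup : w₂ ∈ ⨆ (ψ) (_ : ψ ≠ χ₀), W ψ := Submodule.span_le.2 (by
    rintro _ ⟨i, hi, rfl⟩
    exact Submodule.mem_iSup_of_mem (χ i) (Submodule.mem_iSup_of_mem hi (mem_W (hv i)))) hw₂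
  have w₂_eq_zero : w₂ = 0 := Submodule.disjoint_def.1 (independent χ₀) w₂
    ((Submodule.add_mem_iff_right _ w₁_mem).1 (mem_W hw)) w₂_mem_iSup
  rwa [w₂_eq_zero, add_zero]

theorem eq_of_forall_pow_eq_pow (R : Type*) [CommRing R] [IsDomain R] [Infinite R] {m n : ℕ}
    (h : ∀ c : R, c ^ m = c ^ n) : m = n := by
  refine (Polynomial.monomial_left_inj (one_ne_zero (α := R))).1 (Polynomial.funext fun c => ?_)
  simpa using h c

variable {X : Type*}

theorem freeMagma_lift_const {M : Type*} [Monoid M] (c : M) (m : FreeMagma X) :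
    FreeMagma.lift (fun _ => c) m = c ^ m.length := by
  induction m using FreeMagma.recOnMul with
  | ih1 _ => exact (pow_one c).symm
  | ih2 a b ha hb => rw [map_mul, ha, hb, ← pow_add]; rfl

theorem exists_eq_of_of_freeMagma_length_eq_one {m : FreeMagma X} (h : m.length = 1) :
    ∃ x, m = .of x := by
  cases m with
  | of x => exact ⟨x, rfl⟩
  | mul a b =>
    have ha := a.length_pos
    have hb := b.length_pos
    change a.length + b.length = 1 at h
    omega

theorem exists_eq_of_mul_of_of_freeMagma_length_eq_two {m : FreeMagma X} (h : m.length = 2) :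
    ∃ x y, m = .of x * .of y := by
  cases m with
  | of x => cases h
  | mul a b =>
    have ha := a.length_pos
    have hb := b.length_pos
    change a.length + b.length = 2 at h
    obtain ⟨x, rfl⟩ := exists_eq_of_of_freeMagma_length_eq_one (m := a) (by omega)
    obtain ⟨y, rfl⟩ := exists_eq_of_of_freeMagma_length_eq_one (m := b) (by omega)
    exact ⟨x, y, rfl⟩

end Weights

namespace FreeJordanAlgebra

section Lift

variable (k : Type u) [Field k] {X : Type}

/-- The quotient map from the absolutely free algebra. -/
def proj : FreeNonUnitalNonAssocAlgebra k X →ₙₐ[k] FreeJordanAlgebra k X where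
  toFun := Quot.mk _
  map_smul' _ _ := rfl
  map_zero' := rfl
  map_add' _ _ := rfl
  map_mul' _ _ := rfl

variable {A : Type*} [NonUnitalNonAssocCommRing A] [Module k A] [IsScalarTower k A A]
  [SMulCommClass k A A]

/-- The homomorphism to a Jordan algebra determined by the images of the free generators. -/
def lift [IsCommJordan A] (f : X → A) : FreeJordanAlgebra k X →ₙₐ[k] A where
  toFun := Quot.lift (FreeNonUnitalNonAssocAlgebra.lift k f) fun a b h => by
    induction h with
    | mul_comm a b => simp only [map_mul, mul_comm]
    | jordan a b => simp only [map_mul]; exact (IsJordan.lmul_lmul_comm_rmul _ _).symm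
    | smul t _ ih => simp only [map_smul, ih]
    | add_right c _ ih => simp only [map_add, ih]
    | mul_left a _ ih => simp only [map_mul, ih]
    | mul_right c _ ih => simp only [map_mul, ih]
  map_smul' t := by rintro ⟨a⟩; exact map_smul (FreeNonUnitalNonAssocAlgebra.lift k f) t a
  map_zero' := map_zero (FreeNonUnitalNonAssocAlgebra.lift k f)
  map_add' := by rintro ⟨a⟩ ⟨b⟩; exact map_add (FreeNonUnitalNonAssocAlgebra.lift k f) a b
  map_mul' := by rintro ⟨a⟩ ⟨b⟩; exact map_mul (FreeNonUnitalNonAssocAlgebra.lift k f) a b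

@[simp]
theorem lift_of [IsCommJordan A] (f : X → A) (x : X) : lift k f (of k X x) = f x :=
  FreeNonUnitalNonAssocAlgebra.lift_of_apply k f x

variable {k}

theorem hom_ext {B : Type*} [NonUnitalNonAssocSemiring B] [Module k B] [IsScalarTower k B B]
    [SMulCommClass k B B] {f g : FreeJordanAlgebra k X →ₙₐ[k] B}
    (h : ∀ x, f (of k X x) = g (of k X x)) : f = g := by
  have comp_proj : f.comp (proj k) = g.comp (proj k) := FreeNonUnitalNonAssocAlgebra.hom_ext k h
  ext ⟨a⟩
  exact DFunLike.congr_fun comp_proj a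

@[elab_as_elim]
theorem induction_on {p : FreeJordanAlgebra k X → Prop} (a : FreeJordanAlgebra k X)
    (of : ∀ x, p (of k X x)) (zero : p 0) (add : ∀ a b, p a → p b → p (a + b))
    (smul : ∀ (c : k) a, p a → p (c • a)) (mul : ∀ a b, p a → p b → p (a * b)) : p a := by
  obtain ⟨a, rfl⟩ : ∃ a', proj k a' = a := Quot.mk_surjective a
  induction a using MonoidAlgebra.induction_linear with
  | zero => exact zero
  | add a b ha hb => rw [map_add]; exact add _ _ ha hb
  | single m c =>
    suffices p (proj k (MonoidAlgebra.single m 1)) by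
      rw [← mul_one c, ← smul_eq_mul, ← MonoidAlgebra.smul_single, map_smul]
      exact smul _ _ this
    induction m using FreeMagma.recOnMul with
    | ih1 x => exact of x
    | ih2 m n hm hn =>
      rw [← one_mul (1 : k), ← MonoidAlgebra.single_mul_single, map_mul]
      exact mul _ _ hm hn

theorem span_eq_top_of_mul_mem {s : Set (FreeJordanAlgebra k X)}
    (of_mem : ∀ x, of k X x ∈ s) (mul_mem : ∀ a ∈ s, ∀ b ∈ s, a * b ∈ s) :
    Submodule.span k s = ⊤ := by
  refine eq_top_iff.2 fun a _ => ?_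
  induction a using induction_on with
  | of x => exact Submodule.subset_span (of_mem x)
  | zero => exact zero_mem _
  | add a b ha hb => exact add_mem (ha trivial) (hb trivial)
  | smul c a ha => exact Submodule.smul_mem _ c (ha trivial)
  | mul a b ha hb =>
    have hab := Submodule.apply_mem_map₂ (LinearMap.mul k _) (ha trivial) (hb trivial)
    rw [Submodule.map₂_span_span] at hab
    exact Submodule.span_mono (Set.image2_subset_iff.2 mul_mem) hab

instance [IsEmpty X] : Subsingleton (FreeJordanAlgebra k X) :=
  subsingleton_of_forall_eq 0 fun a =>
    DFunLike.congr_fun (hom_ext isEmptyElim : NonUnitalAlgHom.id k _ = 0) a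

variable (k) in
/-- The image of a nonassociative monomial. -/
def mon : FreeMagma X →ₙ* FreeJordanAlgebra k X := FreeMagma.lift (of k X)

variable (k X) in
theorem span_range_mon : Submodule.span k (Set.range (mon k (X := X))) = ⊤ :=
  span_eq_top_of_mul_mem (fun x => ⟨.of x, rfl⟩) <| by
    rintro _ ⟨m, rfl⟩ _ ⟨n, rfl⟩
    exact ⟨m * n, map_mul _ _ _⟩

end Lift

section ChangeOfScalars

variable {k l m : Type u} [Field k] [Field l] [Field m] {X : Type}

/-- The semilinear homomorphism of free Jordan algebras that fixes the generators and acts on the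
scalars through a homomorphism of fields. -/
def mapScalars (σ : k →+* l) :
    FreeJordanAlgebra k X →ₛₙₐ[(σ : k →* l)] FreeJordanAlgebra l X :=
  letI : Module k (FreeJordanAlgebra l X) := Module.compHom _ σ
  haveI : IsScalarTower k (FreeJordanAlgebra l X) (FreeJordanAlgebra l X) :=
    ⟨fun c a b => smul_mul_assoc (σ c) a b⟩
  haveI : SMulCommClass k (FreeJordanAlgebra l X) (FreeJordanAlgebra l X) :=
    ⟨fun c a b => (mul_smul_comm (σ c) a b).symm⟩
  let f : FreeJordanAlgebra k X →ₙₐ[k] FreeJordanAlgebra l X := lift k (of l X)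
  { toFun := f
    map_smul' := map_smul f
    map_zero' := map_zero f
    map_add' := map_add f
    map_mul' := map_mul f }

@[simp]
theorem mapScalars_of (σ : k →+* l) (x : X) : mapScalars σ (of k X x) = of l X x :=
  letI : Module k (FreeJordanAlgebra l X) := Module.compHom _ σ
  haveI : IsScalarTower k (FreeJordanAlgebra l X) (FreeJordanAlgebra l X) :=
    ⟨fun c a b => smul_mul_assoc (σ c) a b⟩
  haveI : SMulCommClass k (FreeJordanAlgebra l X) (FreeJordanAlgebra l X) :=
    ⟨fun c a b => (mul_smul_comm (σ c) a b).symm⟩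
  lift_of k (of l X) x

theorem mapScalars_smul (σ : k →+* l) (c : k) (a : FreeJordanAlgebra k X) :
    mapScalars σ (c • a) = σ c • mapScalars σ a :=
  map_smulₛₗ _ _ _

theorem mapScalars_id (a : FreeJordanAlgebra k X) : mapScalars (RingHom.id k) a = a := by
  induction a using induction_on with
  | of x => exact mapScalars_of _ x
  | zero => exact map_zero _
  | add a b ha hb => rw [map_add, ha, hb]
  | smul c a ha => rw [mapScalars_smul, ha, RingHom.id_apply]
  | mul a b ha hb => rw [map_mul, ha, hb]

theorem mapScalars_mapScalars (τ : l →+* m) (σ : k →+* l) (a : FreeJordanAlgebra k X) :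
    mapScalars τ (mapScalars σ a) = mapScalars (τ.comp σ) a := by
  induction a using induction_on with
  | of x => simp only [mapScalars_of]
  | zero => simp only [map_zero]
  | add a b ha hb => simp only [map_add, ha, hb]
  | smul c a ha => simp only [mapScalars_smul, ha, RingHom.comp_apply]
  | mul a b ha hb => simp only [map_mul, ha, hb]

variable (k X) in
/-- The action of the automorphisms of the field on the free Jordan algebra, fixing the
generators. -/
def twist : RingAut k →* RingAut (FreeJordanAlgebra k X) where
  toFun φ :=
    { toFun := mapScalars φ.toRingHom
      invFun := mapScalars φ.symm.toRingHom
      left_inv := fun a => by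
        rw [mapScalars_mapScalars, RingEquiv.symm_toRingHom_comp_toRingHom, mapScalars_id]
      right_inv := fun a => by
        rw [mapScalars_mapScalars, RingEquiv.toRingHom_comp_symm_toRingHom, mapScalars_id]
      map_add' := map_add _
      map_mul' := map_mul _ }
  map_one' := RingEquiv.ext mapScalars_id
  map_mul' φ ψ := RingEquiv.ext fun a => by
    rw [RingAut.mul_apply]
    exact (mapScalars_mapScalars (φ : k →+* k) (ψ : k →+* k) a).symm

@[simp]
theorem twist_of (φ : RingAut k) (x : X) : twist k X φ (of k X x) = of k X x :=
  mapScalars_of (φ : k →+* k) x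

@[simp]
theorem twist_smul (φ : RingAut k) (c : k) (a : FreeJordanAlgebra k X) :
    twist k X φ (c • a) = φ c • twist k X φ a :=
  mapScalars_smul (φ : k →+* k) c a

end ChangeOfScalars

section LinearPart

variable {k : Type u} [Field k] {X Y : Type}

variable (k X) in
/-- The quotient of the free Jordan algebra by all products, realised in the square-zero ideal of
the trivial extension of `k` by the module of formal combinations of generators. -/
def toTrivSqZeroExt : FreeJordanAlgebra k X →ₙₐ[k] TrivSqZeroExt k (X →₀ k) :=
  lift k fun x => TrivSqZeroExt.inr (Finsupp.single x 1)

@[simp]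
theorem fst_toTrivSqZeroExt (a : FreeJordanAlgebra k X) : (toTrivSqZeroExt k X a).fst = 0 := by
  induction a using induction_on with
  | of x => rw [toTrivSqZeroExt, lift_of, TrivSqZeroExt.fst_inr]
  | zero => rw [map_zero, TrivSqZeroExt.fst_zero]
  | add a b ha hb => rw [map_add, TrivSqZeroExt.fst_add, ha, hb, add_zero]
  | smul c a ha => rw [map_smul, TrivSqZeroExt.fst_smul, ha, smul_zero]
  | mul a b ha _ => rw [map_mul, TrivSqZeroExt.fst_mul, ha, zero_mul]

variable (k X) in
/-- The homogeneous component of degree one, as a formal combination of the generators. -/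
def linearPart : FreeJordanAlgebra k X →ₗ[k] X →₀ k :=
  TrivSqZeroExt.sndHom k (X →₀ k) ∘ₗ
    (toTrivSqZeroExt k X : FreeJordanAlgebra k X →ₗ[k] TrivSqZeroExt k (X →₀ k))

@[simp]
theorem linearPart_of (x : X) : linearPart k X (of k X x) = Finsupp.single x 1 :=
  congrArg TrivSqZeroExt.snd (lift_of k _ x)

@[simp]
theorem linearPart_mul (a b : FreeJordanAlgebra k X) : linearPart k X (a * b) = 0 := by
  change (toTrivSqZeroExt k X (a * b)).snd = 0
  simp only [map_mul, TrivSqZeroExt.snd_mul, fst_toTrivSqZeroExt, MulOpposite.op_zero, zero_smul,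
    add_zero]

theorem of_ne_zero (x : X) : of k X x ≠ 0 := fun h => by
  simpa using congrArg (linearPart k X) h

theorem linearPart_surjective : Function.Surjective (linearPart k X) :=
  LinearMap.range_eq_top.1 <| eq_top_iff.2 fun a _ => by
    induction a using Finsupp.induction_linear with
    | zero => exact zero_mem _
    | add a b ha hb => exact add_mem (ha trivial) (hb trivial)
    | single x c => exact ⟨c • of k X x, by simp⟩

theorem linearPart_map (f : FreeJordanAlgebra k X →ₙₐ[k] FreeJordanAlgebra k Y)
    (a : FreeJordanAlgebra k X) :
    linearPart k Y (f a) =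
      Finsupp.linearCombination k (fun x => linearPart k Y (f (of k X x))) (linearPart k X a) := by
  induction a using induction_on with
  | of x => simp
  | zero => simp
  | add a b ha hb => simp [ha, hb]
  | smul c a ha => simp [ha]
  | mul a b _ _ => simp

theorem card_le_of_surjective [Fintype X] [Fintype Y]
    (f : FreeJordanAlgebra k X →ₙₐ[k] FreeJordanAlgebra k Y) (hf : Function.Surjective f) :
    Fintype.card Y ≤ Fintype.card X := by
  refine card_le_of_surjective' k
    (Finsupp.linearCombination k fun x => linearPart k Y (f (of k X x))) fun v => ?_
  obtain ⟨b, rfl⟩ := linearPart_surjective v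
  obtain ⟨a, rfl⟩ := hf b
  exact ⟨linearPart k X a, (linearPart_map f a).symm⟩

end LinearPart

section RankOne

open Polynomial

variable (k : Type u) [Field k] (X : Type)

/-- The evaluation of all generators at the polynomial variable. -/
def toPolynomial : FreeJordanAlgebra k X →ₙₐ[k] k[X] := lift k fun _ => Polynomial.X

variable {k X} {Y : Type}

@[simp]
theorem toPolynomial_of (x : X) : toPolynomial k X (of k X x) = Polynomial.X := lift_of k _ x

theorem of_mul_of_ne_zero (x y : X) : of k X x * of k X y ≠ 0 := fun h => by
  simpa using congrArg (toPolynomial k X) h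

theorem toPolynomial_powSucc (x : X) (n : ℕ) :
    toPolynomial k X (powSucc (of k X x) n) = Polynomial.X ^ (n + 1) := by
  induction n with
  | zero => rw [powSucc, toPolynomial_of, zero_add, pow_one]
  | succ n ih => rw [powSucc, map_mul, ih, toPolynomial_of, ← pow_succ']

theorem coeff_zero_toPolynomial (a : FreeJordanAlgebra k X) :
    (toPolynomial k X a).coeff 0 = 0 := by
  induction a using induction_on with
  | of x => simp
  | zero => simp
  | add a b ha hb => simp [ha, hb]
  | smul c a ha => simp [ha]
  | mul a b ha _ => simp [ha]

theorem toPolynomial_map [Unique X]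
    (f : FreeJordanAlgebra k X →ₙₐ[k] FreeJordanAlgebra k Y) (a : FreeJordanAlgebra k X) :
    toPolynomial k Y (f a) =
      (toPolynomial k X a).comp (toPolynomial k Y (f (of k X default))) := by
  induction a using induction_on with
  | of x => simp [Subsingleton.elim x default]
  | zero => simp
  | add a b ha hb => simp [ha, hb]
  | smul c a ha => simp [ha]
  | mul a b ha hb => simp [ha, hb]

theorem isSMulRegular_two [NeZero (2 : k)] : IsSMulRegular (FreeJordanAlgebra k X) 2 :=
  fun a b h => smul_right_injective _ (two_ne_zero (α := k)) <|
    (ofNat_smul_eq_nsmul k 2 a).trans (h.trans (ofNat_smul_eq_nsmul k 2 b).symm)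

theorem toPolynomial_injective [NeZero (2 : k)] [Unique X] :
    Function.Injective (toPolynomial k X) := by
  have span_powers : Submodule.span k (Set.range (powSucc (of k X default))) = ⊤ := by
    refine span_eq_top_of_mul_mem (fun x => ⟨0, congrArg (of k X) (Subsingleton.elim _ _)⟩) ?_
    rintro _ ⟨m, rfl⟩ _ ⟨n, rfl⟩
    exact ⟨m + n + 1, (powSucc_mul_powSucc isSMulRegular_two _ m n).symm⟩
  have linearIndependent_powers :
      LinearIndependent k ((toPolynomial k X : _ →ₗ[k] k[X]) ∘ powSucc (of k X default)) := by
    convert (basisMonomials k).linearIndependent.comp (· + 1) (add_left_injective 1) using 1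
    funext n
    simpa [X_pow_eq_monomial] using toPolynomial_powSucc default n
  have disjoint_ker := Submodule.range_ker_disjoint linearIndependent_powers
  rw [span_powers, top_disjoint] at disjoint_ker
  exact LinearMap.ker_eq_bot.1 disjoint_ker

theorem exists_apply_of_eq_smul_of [NeZero (2 : k)] [Unique X] [Unique Y]
    (f : FreeJordanAlgebra k X →ₙₐ[k] FreeJordanAlgebra k Y) (hf : Function.Surjective f) :
    ∃ c : k, c ≠ 0 ∧ f (of k X default) = c • of k Y default := by
  set q := toPolynomial k Y (f (of k X default)) with hq
  have natDegree_q : q.natDegree = 1 := by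
    obtain ⟨a, ha⟩ := hf (of k Y default)
    have comp_q := toPolynomial_map f a
    rw [ha, toPolynomial_of] at comp_q
    refine Nat.eq_one_of_mul_eq_one_left (m := (toPolynomial k X a).natDegree) ?_
    rw [← natDegree_comp, ← comp_q, natDegree_X]
  refine ⟨q.coeff 1, fun h => ?_, toPolynomial_injective ?_⟩
  · rw [← natDegree_q, coeff_natDegree, leadingCoeff_eq_zero] at h
    simp [h] at natDegree_q
  · rw [map_smul, toPolynomial_of, smul_eq_C_mul, ← hq]
    conv_lhs => rw [eq_X_add_C_of_natDegree_le_one natDegree_q.le]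
    rw [coeff_zero_toPolynomial, map_zero, add_zero]

end RankOne

section Homogeneity

variable {k : Type u} [Field k] {X : Type}

/-- The endomorphism multiplying each generator by a scalar. -/
def scale (t : X → k) : FreeJordanAlgebra k X →ₙₐ[k] FreeJordanAlgebra k X :=
  lift k fun x => t x • of k X x

@[simp]
theorem scale_of (t : X → k) (x : X) : scale t (of k X x) = t x • of k X x := lift_of k _ x

theorem scale_scale (s t : X → k) (a : FreeJordanAlgebra k X) :
    scale s (scale t a) = scale (s * t) a := by
  have comp : (scale s).comp (scale t) = scale (s * t) := hom_ext fun x => by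
    simp [smul_smul, mul_comm]
  exact DFunLike.congr_fun comp a

/-- `FreeMagma.lift t m` is the value of the monomial `m` at the point `t`. -/
theorem scale_mon (t : X → k) (m : FreeMagma X) :
    scale t (mon k m) = FreeMagma.lift t m • mon k m := by
  induction m using FreeMagma.recOnMul with
  | ih1 x => exact scale_of _ x
  | ih2 a b ha hb => simp only [map_mul, ha, hb, smul_mul_smul_comm]

theorem mem_span_mon_of_forall_scale_eq_smul {T : Type*} {t : T → X → k} {χ : T → k}
    {w : FreeJordanAlgebra k X} (hw : ∀ i, scale (t i) w = χ i • w) :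
    w ∈ Submodule.span k (mon k '' {m : FreeMagma X | ∀ i, FreeMagma.lift (t i) m = χ i}) := by
  let f (i : T) : Module.End k (FreeJordanAlgebra k X) := scale (t i)
  have comm (i j : T) : Commute (f i) (f j) := LinearMap.ext fun a => by
    change scale (t i) (scale (t j) a) = scale (t j) (scale (t i) a)
    rw [scale_scale, scale_scale, mul_comm]
  simpa only [funext_iff] using mem_span_of_forall_apply_eq_smul
    (χ := fun m i => FreeMagma.lift (t i) m) comm (fun m i => scale_mon (t i) m) hw
    (span_range_mon k X ▸ Submodule.mem_top)

theorem mem_span_of_of_forall_scale [Infinite k] {w : FreeJordanAlgebra k X}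
    (hw : ∀ c : k, scale (fun _ => c) w = c • w) : w ∈ Submodule.span k (Set.range (of k X)) := by
  refine Submodule.span_mono ?_ (mem_span_mon_of_forall_scale_eq_smul hw)
  rintro _ ⟨m, hm, rfl⟩
  have length_m : m.length = 1 := eq_of_forall_pow_eq_pow k fun c => by
    rw [← freeMagma_lift_const, hm, pow_one]
  obtain ⟨x, rfl⟩ := exists_eq_of_of_freeMagma_length_eq_one length_m
  exact ⟨x, rfl⟩

theorem mem_span_of_mul_of_of_forall_scale [Infinite k] {x y : X} {w : FreeJordanAlgebra k X}
    (hw : ∀ t : X → k, scale t w = (t x * t y) • w) :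
    w ∈ Submodule.span k {of k X x * of k X y} := by
  classical
  refine Submodule.span_mono ?_ (mem_span_mon_of_forall_scale_eq_smul hw)
  rintro _ ⟨m, hm, rfl⟩
  have length_m : m.length = 2 := eq_of_forall_pow_eq_pow k fun c => by
    rw [← freeMagma_lift_const, hm, pow_two]
  obtain ⟨a, b, rfl⟩ := exists_eq_of_mul_of_of_freeMagma_length_eq_two length_m
  have pair_eq : ({a, b} : Set X) = {x, y} := Set.ext fun z => by
    have eval : (if a = z then 0 else 1) * (if b = z then 0 else 1) =
        (if x = z then 0 else 1) * (if y = z then (0 : k) else 1) :=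
      hm fun u => if u = z then 0 else 1
    simp only [Set.mem_insert_iff, Set.mem_singleton_iff, eq_comm (a := z)]
    grind
  rcases Set.pair_eq_pair_iff.1 pair_eq with ⟨rfl, rfl⟩ | ⟨rfl, rfl⟩
  · rfl
  · exact mul_comm _ _

end Homogeneity

end FreeJordanAlgebra

namespace FreeJordanCat

open FreeJordanAlgebra

variable {k : Type u} [Field k]

instance : ConcreteCategory (FreeJordanCat k) fun A B => A.algebra k →ₙₐ[k] B.algebra k where
  hom f := f
  ofHom f := f

/-- The morphism determined by the images of the free generators. -/
def desc {A B : FreeJordanCat k} (f : A.gens → B.algebra k) : A ⟶ B :=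
  FreeJordanAlgebra.lift k f

@[simp]
theorem desc_of {A B : FreeJordanCat k} (f : A.gens → B.algebra k) (x : A.gens) :
    desc f (of k A.gens x) = f x :=
  lift_of k f x

theorem hom_ext_of {A B : FreeJordanCat k} {f g : A ⟶ B}
    (h : ∀ x, f (of k A.gens x) = g (of k A.gens x)) : f = g :=
  FreeJordanAlgebra.hom_ext (k := k) h

/-- The isomorphism given by a bijective homomorphism. -/
def isoOfBijective {A B : FreeJordanCat k} (f : A ⟶ B) (hf : Function.Bijective f) : A ≅ B where
  hom := f
  inv := NonUnitalAlgHom.inverse f (Equiv.ofBijective _ hf).symm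
    (Equiv.ofBijective _ hf).left_inv (Equiv.ofBijective _ hf).right_inv
  hom_inv_id := NonUnitalAlgHom.ext (Equiv.ofBijective _ hf).left_inv
  inv_hom_id := NonUnitalAlgHom.ext (Equiv.ofBijective _ hf).right_inv

section Rank

theorem card_gens_le_of_isSplitEpi {A B : FreeJordanCat k} (f : A ⟶ B) [IsSplitEpi f] :
    B.gens.card ≤ A.gens.card := by
  have surjective : Function.Surjective f := fun b =>
    ⟨section_ f b, by rw [← ConcreteCategory.comp_apply, IsSplitEpi.id, ConcreteCategory.id_apply]⟩
  simpa only [Fintype.card_coe] using card_le_of_surjective _ surjective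

theorem nontrivial_end_iff (A : FreeJordanCat k) : Nontrivial (A ⟶ A) ↔ Nonempty A.gens := by
  constructor
  · contrapose!
    exact fun _ => ⟨fun f g => hom_ext_of isEmptyElim⟩
  · rintro ⟨x⟩
    refine ⟨𝟙 A, desc 0, fun h => of_ne_zero (k := k) x ?_⟩
    simpa using congrArg (fun f : A ⟶ A => f (of k A.gens x)) h

theorem nonempty_gens_obj_iff (Φ : FreeJordanCat k ⥤ FreeJordanCat k) [Φ.Full] [Φ.Faithful]
    (A : FreeJordanCat k) : Nonempty (Φ.obj A).gens ↔ Nonempty A.gens := by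
  rw [← nontrivial_end_iff, ← nontrivial_end_iff]
  exact (Functor.FullyFaithful.ofFullyFaithful Φ).homEquiv.nontrivial_congr.symm

theorem nonempty_gens_iff_of_iso {A B : FreeJordanCat k} (e : A ≅ B) :
    Nonempty A.gens ↔ Nonempty B.gens := by
  rw [← nontrivial_end_iff, ← nontrivial_end_iff]
  exact (e.homCongr e).nontrivial_congr

variable (k) in
/-- The free Jordan algebra of rank one. -/
def line : FreeJordanCat k := ⟨{0}⟩

instance : Unique (line k).gens := inferInstanceAs (Unique ({0} : Finset ℕ))

theorem card_gens_obj_line (Φ : FreeJordanCat k ⥤ FreeJordanCat k) [Φ.IsEquivalence] :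
    (Φ.obj (line k)).gens.card = 1 := by
  refine le_antisymm ?_ ?_
  · let N := Φ.objPreimage (line k)
    let e : Φ.obj N ≅ line k := Φ.objObjPreimageIso (line k)
    obtain ⟨n⟩ : Nonempty N.gens :=
      (nonempty_gens_obj_iff Φ N).1 ((nonempty_gens_iff_of_iso e).2 ⟨default⟩)
    let r : N ⟶ line k := desc fun _ => of k _ default
    have : IsSplitEpi r := .mk' ⟨desc fun _ => of k _ n, hom_ext_of fun x => by
      simp [r, Subsingleton.elim x default]⟩
    exact card_gens_le_of_isSplitEpi (e.inv ≫ Φ.map r)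
  · rw [Nat.one_le_iff_ne_zero, Finset.card_ne_zero, ← Finset.nonempty_coe_sort,
      nonempty_gens_obj_iff]
    exact ⟨default⟩

instance uniqueGensObjLine (Φ : FreeJordanCat k ⥤ FreeJordanCat k) [Φ.IsEquivalence] :
    Unique (Φ.obj (line k)).gens :=
  (Fintype.card_eq_one_iff_nonempty_unique.1
    ((Fintype.card_coe _).trans (card_gens_obj_line Φ))).some

end Rank

section Points

/-- The morphisms from a free algebra of rank one correspond to the elements of the target. -/
def pointEquiv (L : FreeJordanCat k) [Unique L.gens] (A : FreeJordanCat k) :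
    (L ⟶ A) ≃ A.algebra k where
  toFun f := f (of k L.gens default)
  invFun a := desc fun _ => a
  left_inv f := hom_ext_of fun x => by rw [desc_of, Subsingleton.elim x default]
  right_inv a := desc_of _ _

variable (L : FreeJordanCat k) [Unique L.gens] {A B : FreeJordanCat k}

@[simp]
theorem pointEquiv_symm_apply_of (a : A.algebra k) (x : L.gens) :
    (pointEquiv L A).symm a (of k L.gens x) = a := desc_of _ _

theorem pointEquiv_symm_apply (f : A ⟶ B) (a : A.algebra k) :
    (pointEquiv L B).symm (f a) = (pointEquiv L A).symm a ≫ f := by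
  rw [Equiv.symm_apply_eq]
  exact congrArg f (pointEquiv_symm_apply_of L a default).symm

theorem pointEquiv_symm_of : (pointEquiv L L).symm (of k L.gens default) = 𝟙 L :=
  (pointEquiv L L).symm_apply_apply (𝟙 L)

theorem isIso_point_smul {c : k} (hc : c ≠ 0) :
    IsIso ((pointEquiv L L).symm (c • of k L.gens default)) := by
  have inv_of_ne_zero {c : k} (hc : c ≠ 0) : (pointEquiv L L).symm (c • of k L.gens default) ≫
      (pointEquiv L L).symm (c⁻¹ • of k L.gens default) = 𝟙 L := by
    rw [← pointEquiv_symm_apply, map_smul, pointEquiv_symm_apply_of, smul_smul,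
      mul_inv_cancel₀ hc, one_smul, pointEquiv_symm_of]
  refine ⟨_, inv_of_ne_zero hc, ?_⟩
  simpa only [inv_inv] using inv_of_ne_zero (inv_ne_zero hc)

theorem mem_span_gen_iff [NeZero (2 : k)] (a : L.algebra k) :
    a ∈ Submodule.span k {of k L.gens default} ↔ a = 0 ∨ IsIso ((pointEquiv L L).symm a) := by
  rw [Submodule.mem_span_singleton]
  constructor
  · rintro ⟨c, rfl⟩
    rcases eq_or_ne c 0 with rfl | hc
    · exact .inl (zero_smul _ _)
    · exact .inr (isIso_point_smul L hc)
  · rintro (rfl | h)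
    · exact ⟨0, zero_smul _ _⟩
    · obtain ⟨c, -, hc⟩ := exists_apply_of_eq_smul_of _
        (ConcreteCategory.bijective_of_isIso ((pointEquiv L L).symm a)).surjective
      exact ⟨c, hc.symm.trans (pointEquiv_symm_apply_of L a default)⟩

end Points

section Transport

variable (Φ : FreeJordanCat k ⥤ FreeJordanCat k) [Φ.IsEquivalence]

/-- The bijection between the elements of an object and those of its image, induced by the functor
on the morphisms from the free algebra of rank one. -/
def transport {A : FreeJordanCat k} : A.algebra k ≃ (Φ.obj A).algebra k :=
  (pointEquiv (line k) A).symm.trans <| (Functor.FullyFaithful.ofFullyFaithful Φ).homEquiv.trans <|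
    pointEquiv (Φ.obj (line k)) (Φ.obj A)

variable {A B : FreeJordanCat k}

theorem pointEquiv_symm_transport (a : A.algebra k) :
    (pointEquiv (Φ.obj (line k)) _).symm (transport Φ a) =
      Φ.map ((pointEquiv (line k) A).symm a) :=
  Equiv.symm_apply_apply _ _

theorem map_transport (f : A ⟶ B) (a : A.algebra k) :
    Φ.map f (transport Φ a) = transport Φ (f a) := by
  apply (pointEquiv (Φ.obj (line k)) _).symm.injective
  rw [pointEquiv_symm_apply, pointEquiv_symm_transport, pointEquiv_symm_transport,
    pointEquiv_symm_apply, Φ.map_comp]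

theorem transport_gen : transport Φ (of k (line k).gens default) =
    of k (Φ.obj (line k)).gens default := by
  apply (pointEquiv (Φ.obj (line k)) _).symm.injective
  rw [pointEquiv_symm_transport, pointEquiv_symm_of, pointEquiv_symm_of, Φ.map_id]

theorem transport_zero : transport Φ (0 : A.algebra k) = 0 := by
  let E : FreeJordanCat k := ⟨∅⟩
  have : IsEmpty E.gens := inferInstanceAs (IsEmpty (∅ : Finset ℕ))
  have : IsEmpty (Φ.obj E).gens := by
    rwa [← not_nonempty_iff, nonempty_gens_obj_iff, not_nonempty_iff]
  let f : E ⟶ A := desc isEmptyElim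
  have h := map_transport Φ f 0
  rwa [Subsingleton.elim (transport Φ (0 : E.algebra k)) 0, map_zero, map_zero, eq_comm] at h

theorem transport_mem_span_gen_iff [NeZero (2 : k)] (a : (line k).algebra k) :
    transport Φ a ∈ Submodule.span k {of k (Φ.obj (line k)).gens default} ↔
      a ∈ Submodule.span k {of k (line k).gens default} := by
  rw [mem_span_gen_iff, mem_span_gen_iff, pointEquiv_symm_transport, isIso_iff_of_reflects_iso,
    ← transport_zero Φ, (transport Φ).apply_eq_iff_eq]

theorem exists_transport_smul [NeZero (2 : k)] (c : k) : ∃ d : k,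
    ∀ {A : FreeJordanCat k} (a : A.algebra k), transport Φ (c • a) = d • transport Φ a := by
  obtain ⟨d, hd⟩ := Submodule.mem_span_singleton.1 <| (transport_mem_span_gen_iff Φ _).2 <|
    Submodule.smul_mem _ c (Submodule.mem_span_singleton_self (of k (line k).gens default))
  refine ⟨d, fun {A} a => ?_⟩
  let p : line k ⟶ A := (pointEquiv (line k) A).symm a
  have hp : p (of k (line k).gens default) = a := pointEquiv_symm_apply_of _ a _
  rw [← hp, ← map_smul, ← map_transport, ← map_transport, ← hd, map_smul, transport_gen]

end Transport

section ScalarMap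

variable (Φ : FreeJordanCat k ⥤ FreeJordanCat k) [Φ.IsEquivalence] [NeZero (2 : k)]
  {A : FreeJordanCat k}

/-- The map on scalars for which `transport Φ` is semilinear. -/
def scalarMap (c : k) : k := (exists_transport_smul Φ c).choose

theorem transport_smul (c : k) (a : A.algebra k) :
    transport Φ (c • a) = scalarMap Φ c • transport Φ a :=
  (exists_transport_smul Φ c).choose_spec a

theorem scalarMap_eq_iff {c d : k} :
    scalarMap Φ c = d ↔ transport Φ (c • of k (line k).gens default) =
      d • of k (Φ.obj (line k)).gens default := by
  rw [transport_smul, transport_gen, (smul_left_injective k (of_ne_zero _)).eq_iff]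

theorem scalarMap_zero : scalarMap Φ 0 = 0 := by
  rw [scalarMap_eq_iff, zero_smul, zero_smul, transport_zero]

theorem scalarMap_one : scalarMap Φ 1 = 1 := by
  rw [scalarMap_eq_iff, one_smul, one_smul, transport_gen]

theorem scalarMap_mul (c d : k) : scalarMap Φ (c * d) = scalarMap Φ c * scalarMap Φ d := by
  rw [scalarMap_eq_iff, mul_smul, transport_smul, transport_smul, transport_gen, mul_smul]

theorem scalarMap_surjective : Function.Surjective (scalarMap Φ) := fun d => by
  obtain ⟨a, ha⟩ := (transport Φ).surjective (d • of k (Φ.obj (line k)).gens default)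
  obtain ⟨c, rfl⟩ := Submodule.mem_span_singleton.1 <| (transport_mem_span_gen_iff Φ a).1 <|
    ha ▸ Submodule.smul_mem _ d (Submodule.mem_span_singleton_self _)
  exact ⟨c, (scalarMap_eq_iff Φ).2 ha⟩

end ScalarMap

section Plane

variable (k) in
/-- The free Jordan algebra of rank two. -/
def plane : FreeJordanCat k := ⟨{0, 1}⟩

variable (k) in
/-- The first free generator of `plane k`. -/
def genX : (plane k).gens := ⟨0, Finset.mem_insert_self 0 {1}⟩

variable (k) in
/-- The second free generator of `plane k`. -/
def genY : (plane k).gens := ⟨1, Finset.mem_insert_of_mem (Finset.mem_singleton_self 1)⟩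

variable {A : FreeJordanCat k}

/-- The morphism from the free algebra of rank two determined by a pair of elements. -/
def pair (a b : A.algebra k) : plane k ⟶ A := desc fun z => if z = genX k then a else b

@[simp]
theorem pair_genX (a b : A.algebra k) : pair a b (of k _ (genX k)) = a :=
  (desc_of _ _).trans (if_pos rfl)

@[simp]
theorem pair_genY (a b : A.algebra k) : pair a b (of k _ (genY k)) = b :=
  (desc_of _ _).trans (if_neg (Subtype.coe_ne_coe.1 Nat.one_ne_zero))

theorem eq_genX_or_eq_genY (z : (plane k).gens) : z = genX k ∨ z = genY k := by
  obtain ⟨n, hn⟩ := z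
  rcases Finset.mem_insert.1 hn with rfl | h
  · exact .inl rfl
  · exact .inr (Subtype.ext (Finset.mem_singleton.1 h))

theorem scale_eq_pair (t : (plane k).gens → k) :
    scale t = pair (t (genX k) • of k _ (genX k)) (t (genY k) • of k _ (genY k)) :=
  FreeJordanAlgebra.hom_ext (k := k) fun z => (scale_of t z).trans <| by
    rcases eq_genX_or_eq_genY z with rfl | rfl
    · exact (pair_genX _ _).symm
    · exact (pair_genY _ _).symm

theorem pair_apply_eq_add {w : (plane k).algebra k}
    (hw : w ∈ Submodule.span k (Set.range (of k (plane k).gens))) (a b : A.algebra k) :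
    pair a b w = pair a 0 w + pair 0 b w := by
  induction hw using Submodule.span_induction with
  | mem _ h =>
    obtain ⟨z, rfl⟩ := h
    rcases eq_genX_or_eq_genY z with rfl | rfl <;> simp
  | zero => simp
  | add u v _ _ hu hv => simp only [map_add, hu, hv]; abel
  | smul c u _ hu => simp only [map_smul, hu, smul_add]

end Plane

section Operations

variable (Φ : FreeJordanCat k ⥤ FreeJordanCat k) [Φ.IsEquivalence] [NeZero (2 : k)] [Infinite k]

theorem transport_add {A : FreeJordanCat k} (a b : A.algebra k) :
    transport Φ (a + b) = transport Φ a + transport Φ b := by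
  obtain ⟨w, hw⟩ := (transport Φ).surjective
    (transport Φ (of k _ (genX k)) + transport Φ (of k _ (genY k)))
  have transport_pair {A : FreeJordanCat k} (a b : A.algebra k) :
      transport Φ (pair a b w) = transport Φ a + transport Φ b := by
    rw [← map_transport, hw, map_add, map_transport, map_transport, pair_genX, pair_genY]
  have linear : w ∈ Submodule.span k (Set.range (of k (plane k).gens)) :=
    mem_span_of_of_forall_scale fun t => (transport Φ).injective <| by
      rw [scale_eq_pair]
      refine (transport_pair _ _).trans ?_
      rw [transport_smul, transport_smul, transport_smul, hw, smul_add]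
  have pair_left : pair a 0 w = a := (transport Φ).injective <| by
    rw [transport_pair, transport_zero, add_zero]
  have pair_right : pair 0 b w = b := (transport Φ).injective <| by
    rw [transport_pair, transport_zero, zero_add]
  rw [← transport_pair, pair_apply_eq_add linear, pair_left, pair_right]

theorem exists_transport_smul_mul : ∃ γ : k, γ ≠ 0 ∧ ∀ {A : FreeJordanCat k} (a b : A.algebra k),
    transport Φ (γ • (a * b)) = transport Φ a * transport Φ b := by
  obtain ⟨w, hw⟩ := (transport Φ).surjective
    (transport Φ (of k _ (genX k)) * transport Φ (of k _ (genY k)))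
  have transport_pair {A : FreeJordanCat k} (a b : A.algebra k) :
      transport Φ (pair a b w) = transport Φ a * transport Φ b := by
    rw [← map_transport, hw, map_mul, map_transport, map_transport, pair_genX, pair_genY]
  have bilinear : w ∈ Submodule.span k {of k _ (genX k) * of k _ (genY k)} :=
    mem_span_of_mul_of_of_forall_scale fun t => (transport Φ).injective <| by
      rw [scale_eq_pair]
      refine (transport_pair _ _).trans ?_
      rw [transport_smul, transport_smul, transport_smul, hw, scalarMap_mul, smul_mul_smul_comm]
  obtain ⟨γ, rfl⟩ := Submodule.mem_span_singleton.1 bilinear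
  simp only [map_smul, map_mul, pair_genX, pair_genY] at transport_pair
  refine ⟨γ, ?_, transport_pair⟩
  rintro rfl
  refine of_mul_of_ne_zero (k := k) (default : (Φ.obj (line k)).gens) default ?_
  rw [← transport_gen, ← transport_pair, zero_smul, transport_zero]

/-- The automorphism of the field of scalars induced by an autoequivalence. -/
def scalarAut : RingAut k :=
  RingEquiv.ofBijective
    { toFun := scalarMap Φ
      map_zero' := scalarMap_zero Φ
      map_one' := scalarMap_one Φ
      map_mul' := scalarMap_mul Φ
      map_add' := fun a b => by
        rw [scalarMap_eq_iff, add_smul, transport_add, transport_smul, transport_smul,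
          transport_gen, add_smul] : k →+* k }
    ⟨RingHom.injective _, scalarMap_surjective Φ⟩

theorem transport_smul_eq_scalarAut_smul {A : FreeJordanCat k} (c : k) (a : A.algebra k) :
    transport Φ (c • a) = scalarAut Φ c • transport Φ a :=
  transport_smul Φ c a

end Operations

section SemiInner

/-- A functor is semi-inner for `φ` if its action on morphisms is conjugation by a family of
`φ`-semilinear ring isomorphisms `F(X) → Φ(F(X))`. -/
def IsSemiInner (φ : RingAut k) (Φ : FreeJordanCat k ⥤ FreeJordanCat k) : Prop :=
  ∃ s : ∀ A : FreeJordanCat k, A.algebra k ≃+* (Φ.obj A).algebra k,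
    (∀ A (c : k) (a : A.algebra k), s A (c • a) = φ c • s A a) ∧
      ∀ {A B} (f : A ⟶ B) (a : A.algebra k), Φ.map f (s A a) = s B (f a)

/-- If `transport Φ (γ • (a * b)) = transport Φ a * transport Φ b`, then `κ⁻¹ • transport Φ` is
multiplicative for the image `κ` of `γ`. -/
theorem isSemiInner_scalarAut [NeZero (2 : k)] [Infinite k]
    (Φ : FreeJordanCat k ⥤ FreeJordanCat k) [Φ.IsEquivalence] : IsSemiInner (scalarAut Φ) Φ := by
  obtain ⟨γ, hγ, transport_mul⟩ := exists_transport_smul_mul Φ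
  let κ : kˣ := Units.map (scalarAut Φ : k →* k) (Units.mk0 γ hγ)
  have κ_smul_transport {A : FreeJordanCat k} (a b : A.algebra k) :
      κ • transport Φ (a * b) = transport Φ a * transport Φ b := by
    rw [← transport_mul, transport_smul_eq_scalarAut_smul]; rfl
  let s (A : FreeJordanCat k) : A.algebra k ≃+* (Φ.obj A).algebra k :=
    { (transport Φ).trans (MulAction.toPerm κ⁻¹) with
      map_mul' := fun a b => by
        change κ⁻¹ • transport Φ (a * b) = (κ⁻¹ • transport Φ a) * (κ⁻¹ • transport Φ b)
        rw [smul_mul_smul_comm, ← κ_smul_transport, smul_smul, inv_mul_cancel_right]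
      map_add' := fun a b => by
        change κ⁻¹ • transport Φ (a + b) = κ⁻¹ • transport Φ a + κ⁻¹ • transport Φ b
        rw [transport_add, smul_add] }
  refine ⟨s, fun A c a => ?_, fun {A B} f a => ?_⟩
  · change κ⁻¹ • transport Φ (c • a) = scalarAut Φ c • κ⁻¹ • transport Φ a
    rw [transport_smul_eq_scalarAut_smul, smul_comm]
  · change Φ.map f ((κ⁻¹ : kˣ).val • transport Φ a) = (κ⁻¹ : kˣ).val • transport Φ (f a)
    rw [map_smul, map_transport]

end SemiInner

section Twist

/-- The automorphism of the category twisting the scalars of all morphisms by `φ`. -/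
def twistFunctor (φ : RingAut k) : FreeJordanCat k ⥤ FreeJordanCat k where
  obj A := A
  map {A B} f :=
    ({ toFun := fun a => twist k B.gens φ (f (twist k A.gens φ⁻¹ a))
       map_smul' := fun c a => by
        rw [twist_smul, map_smul, twist_smul, RingAut.inv_apply, RingEquiv.apply_symm_apply]
        rfl
       map_zero' := by simp only [map_zero]
       map_add' := fun a b => by simp only [map_add]
       map_mul' := fun a b => by simp only [map_mul] } : A.algebra k →ₙₐ[k] B.algebra k)
  map_id A := NonUnitalAlgHom.ext fun a => by
    change twist k A.gens φ (twist k A.gens φ⁻¹ a) = a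
    rw [map_inv, RingAut.inv_apply, RingEquiv.apply_symm_apply]
  map_comp {A B C} f g := NonUnitalAlgHom.ext fun a => by
    change twist k C.gens φ (g (f (twist k A.gens φ⁻¹ a))) =
      twist k C.gens φ (g (twist k B.gens φ⁻¹ (twist k B.gens φ (f (twist k A.gens φ⁻¹ a)))))
    rw [map_inv (twist k B.gens), RingAut.inv_apply, RingEquiv.symm_apply_apply]

theorem twistFunctor_comp (φ ψ : RingAut k) :
    twistFunctor ψ ⋙ twistFunctor φ = twistFunctor (φ * ψ) := by
  refine CategoryTheory.Functor.hext (fun A => rfl) fun A B f => heq_of_eq ?_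
  refine NonUnitalAlgHom.ext fun (a : A.algebra k) => ?_
  change twist k B.gens φ (twist k B.gens ψ (f (twist k A.gens ψ⁻¹ (twist k A.gens φ⁻¹ a)))) =
    twist k B.gens (φ * ψ) (f (twist k A.gens (φ * ψ)⁻¹ a))
  rw [mul_inv_rev, map_mul, map_mul, RingAut.mul_apply, RingAut.mul_apply]

theorem twistFunctor_one : twistFunctor (1 : RingAut k) = 𝟭 _ := by
  refine CategoryTheory.Functor.hext (fun A => rfl) fun A B f => heq_of_eq ?_
  refine NonUnitalAlgHom.ext fun (a : A.algebra k) => ?_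
  change twist k B.gens 1 (f (twist k A.gens 1⁻¹ a)) = f a
  rw [inv_one, map_one, map_one, RingAut.one_apply, RingAut.one_apply]

variable (k) in
/-- The action of the automorphisms of the field on the category. -/
def twistHom : RingAut k →* AutGroup k where
  toFun φ :=
    { hom := (twistFunctor φ).toCatHom
      inv := (twistFunctor φ⁻¹).toCatHom
      hom_inv_id := Cat.Hom.ext <| by
        change twistFunctor φ ⋙ twistFunctor φ⁻¹ = 𝟭 _
        rw [twistFunctor_comp, inv_mul_cancel, twistFunctor_one]
      inv_hom_id := Cat.Hom.ext <| by
        change twistFunctor φ⁻¹ ⋙ twistFunctor φ = 𝟭 _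
        rw [twistFunctor_comp, mul_inv_cancel, twistFunctor_one] }
  map_one' := Aut.ext <| Cat.Hom.ext twistFunctor_one
  map_mul' φ ψ := Aut.ext <| Cat.Hom.ext (twistFunctor_comp φ ψ).symm

theorem eq_one_of_iso_twistFunctor [NeZero (2 : k)] {φ : RingAut k}
    (e : 𝟭 (FreeJordanCat k) ≅ twistFunctor φ) : φ = 1 := by
  let f : line k ⟶ line k := e.hom.app (line k)
  let x := of k (line k).gens default
  obtain ⟨d, hd, hf⟩ : ∃ d ≠ 0, f x = d • x :=
    exists_apply_of_eq_smul_of (k := k) _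
      (ConcreteCategory.bijective_of_isIso (e.hom.app (line k))).surjective
  ext c
  let h : line k ⟶ line k := (pointEquiv (line k) _).symm (c • x)
  have hx : h x = c • x := pointEquiv_symm_apply_of _ _ _
  have natural : f (h x) = twist k _ φ (h (twist k _ φ⁻¹ (f x))) :=
    congrArg (fun g : line k ⟶ line k => g x) (e.hom.naturality h)
  rw [hx, map_smul, hf, twist_smul, twist_of, map_smul, hx, twist_smul, twist_smul, twist_of,
    RingAut.inv_apply, RingEquiv.apply_symm_apply, smul_comm] at natural
  exact (smul_left_injective k (of_ne_zero (k := k) default)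
    (smul_right_injective _ hd natural)).symm

theorem IsSemiInner.nonempty_twistFunctor_iso {φ : RingAut k}
    {Φ : FreeJordanCat k ⥤ FreeJordanCat k} (h : IsSemiInner φ Φ) :
    Nonempty (twistFunctor φ ≅ Φ) := by
  obtain ⟨s, s_smul, s_natural⟩ := h
  let η (A : FreeJordanCat k) : A ⟶ Φ.obj A :=
    ({ toFun := fun a => s A (twist k A.gens φ⁻¹ a)
       map_smul' := fun c a => by
        rw [twist_smul, s_smul, RingAut.inv_apply, RingEquiv.apply_symm_apply]
        rfl
       map_zero' := by simp only [map_zero]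
       map_add' := fun a b => by simp only [map_add]
       map_mul' := fun a b => by simp only [map_mul] } :
      A.algebra k →ₙₐ[k] (Φ.obj A).algebra k)
  have η_bijective (A : FreeJordanCat k) : Function.Bijective (η A) :=
    (s A).bijective.comp (twist k A.gens φ⁻¹).bijective
  refine ⟨NatIso.ofComponents (fun A => isoOfBijective (η A) (η_bijective A)) fun {A B} f => ?_⟩
  refine NonUnitalAlgHom.ext fun a => ?_
  change s B (twist k B.gens φ⁻¹ (twist k B.gens φ (f (twist k A.gens φ⁻¹ a)))) =
    Φ.map f (s A (twist k A.gens φ⁻¹ a))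
  rw [map_inv (twist k B.gens), RingAut.inv_apply, RingEquiv.symm_apply_apply, s_natural]

theorem twistHom_inv_mul_mem_innerSubgroup {φ : RingAut k} {Φ : AutGroup k}
    (h : IsSemiInner φ Φ.hom.toFunctor) : (twistHom k φ)⁻¹ * Φ ∈ innerSubgroup k := by
  obtain ⟨e⟩ := h.nonempty_twistFunctor_iso
  refine ⟨eqToIso ?_ ≪≫ Functor.isoWhiskerRight e (twistFunctor φ⁻¹)⟩
  rw [twistFunctor_comp, inv_mul_cancel, twistFunctor_one]

theorem exists_isSemiInner [NeZero (2 : k)] [Infinite k] (Φ : AutGroup k) :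
    ∃ φ : RingAut k, IsSemiInner φ Φ.hom.toFunctor := by
  let F : FreeJordanCat k ⥤ FreeJordanCat k := Φ.hom.toFunctor
  have : F.IsEquivalence := (Cat.equivOfIso Φ).isEquivalence_functor
  exact ⟨scalarAut F, isSemiInner_scalarAut F⟩

end Twist

end FreeJordanCat

end

theorem mainTheorem4_general (k : Type u) [Field k] [Infinite k] [NeZero (2 : k)] :
    Nonempty ((FreeJordanCat.AutGroup k ⧸ FreeJordanCat.innerSubgroup k) ≃* RingAut k) := by
  let twistClass : RingAut k →* FreeJordanCat.AutGroup k ⧸ FreeJordanCat.innerSubgroup k :=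
    (QuotientGroup.mk' _).comp (FreeJordanCat.twistHom k)
  have injective : Function.Injective twistClass :=
    (injective_iff_map_eq_one twistClass).2 fun φ hφ => by
      obtain ⟨e⟩ := (QuotientGroup.eq_one_iff (FreeJordanCat.twistHom k φ)).1 hφ
      exact FreeJordanCat.eq_one_of_iso_twistFunctor e
  have surjective : Function.Surjective twistClass := fun q => by
    obtain ⟨Φ, rfl⟩ := QuotientGroup.mk_surjective q
    obtain ⟨φ, hφ⟩ := FreeJordanCat.exists_isSemiInner Φ
    exact ⟨φ, QuotientGroup.eq.2 (FreeJordanCat.twistHom_inv_mul_mem_innerSubgroup hφ)⟩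
  exact ⟨(MulEquiv.ofBijective twistClass ⟨injective, surjective⟩).symm⟩

theorem mainTheorem4 (k : Type u) [Field k] [CharZero k] :
    Nonempty ((FreeJordanCat.AutGroup k ⧸ FreeJordanCat.innerSubgroup k) ≃* RingAut k) := by
  have : Infinite k := CharZero.infinite k
  exact mainTheorem4_general k
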